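/- For $n\in\mathbb{N}$, $n\ge 1$, let $(P_{k,n})_{k\ge 0}$ be the monic polynomials of degree $k$ that are orthogonal for the inner product $\langle f,g\rangle_n=\int_{\mathbb{C}}\overline{f(z)}\,g(z)\,e^{-nV(z)}\,d^2z$ with the pure Gaussian potential $V(z)=|z|^2$, let $p_{k,n}=P_{k,n}/\sqrt{\langle P_{k,n},P_{k,n}\rangle_n}$ be the orthonormal polynomials, let $$K_n(w,z)=e^{-\frac n2(V(w)+V(z))}\sum_{k=0}^{n-1}\overline{p_{k,n}(w)}\,p_{k,n}(z)$$ be the normalized reproducing kernel, and for $m\ge 1$ let $R_n^{(m)}(z_1,\dots,z_m)=\det\bigl(K_n(z_k,z_l)\bigr)_{k,l=1}^m$ be the $m$-point correlation function. Let $\operatorname{erfc}(z)=\frac{2}{\sqrt\pi}\int_z^\infty e^{-w^2}\,dw$ for $z\in\mathbb{C}$, with the integral along $w=z+t$, $t\ge 0$. Then for all $m\ge 1$, $a_1,\dots,a_m\in\mathbb{C}$ and $z_0\in\mathbb{C}$: 1. if $|z_0|<1$, $$\lim_{n\to\infty}\frac{1}{n^m}R_n^{(m)}\Bigl(z_0+\tfrac{a_1}{\sqrt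 n},\dots,z_0+\tfrac{a_m}{\sqrt n}\Bigr)=\det\Bigl(\tfrac1\pi e^{-\frac12|a_k-a_l|^2+i\,\mathrm{Im}(\overline{a_k}a_l)}\Bigr)_{k,l=1}^m;$$ 2. if $|z_0|>1$, $$\lim_{n\to\infty}\frac{1}{n^m}R_n^{(m)}\Bigl(z_0+\tfrac{a_1}{\sqrt n},\dots,z_0+\tfrac{a_m}{\sqrt n}\Bigr)=0;$$ 3. if $|z_0|=1$, $$\lim_{n\to\infty}\frac{1}{n^m}R_n^{(m)}\Bigl(z_0\bigl(1+\tfrac{a_1}{\sqrt n}\bigr),\dots,z_0\bigl(1+\tfrac{a_m}{\sqrt n}\bigr)\Bigr)=\det\Bigl(\tfrac{1}{2\pi}\operatorname{erfc}\bigl(\tfrac{\overline{a_k}+a_l}{\sqrt2}\bigr)\,e^{-\frac12|a_k-a_l|^2+i\,\mathrm{Im}(\overline{a_k}a_l)}\Bigr)_{k,l=1}^m.$$ -/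

import Mathlib

open MeasureTheory Filter Topology ComplexConjugate

noncomputable section

namespace NormalMatrixModel

/-- The inner product `∫_D conj (f z) * g z * exp (-n V z) d²z` of the normal matrix model with
potential `V`, dimension parameter `n` and cut-off `D`. -/
def ip (V : ℂ → ℝ) (D : Set ℂ) (n : ℕ) (f g : ℂ → ℂ) : ℂ :=
  ∫ z in D, conj (f z) * g z * (Real.exp (-(n : ℝ) * V z) : ℂ)

/-- `P` is the family of monic orthogonal polynomials for `ip V D n`, with positive normalization
constants (and convergent integrals). -/
structure IsOrthogonalFamily (V : ℂ → ℝ) (D : Set ℂ) (n : ℕ) (P : ℕ → Polynomial ℂ) : Prop where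
  monic : ∀ k, (P k).Monic
  natDegree_eq : ∀ k, (P k).natDegree = k
  integrable : ∀ k l, IntegrableOn
    (fun z => conj ((P k).eval z) * (P l).eval z * (Real.exp (-(n : ℝ) * V z) : ℂ)) D
  orthogonal : ∃ h : ℕ → ℝ, (∀ k, 0 < h k) ∧
    ∀ k l, ip V D n (fun z => (P k).eval z) (fun z => (P l).eval z)
      = if k = l then (h k : ℂ) else 0

open Classical in
/-- The monic orthogonal polynomials for `ip V D n`. A family with the defining property is
unique when it exists; the value is `0` when there is none. -/
def orthoPoly (V : ℂ → ℝ) (D : Set ℂ) (n : ℕ) : ℕ → Polynomial ℂ :=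
  if h : ∃ P, IsOrthogonalFamily V D n P then h.choose else 0

/-- The normalization constant `h k = ⟨P k, P k⟩`. -/
def normConst (V : ℂ → ℝ) (D : Set ℂ) (n k : ℕ) : ℝ :=
  (ip V D n (fun z => (orthoPoly V D n k).eval z) (fun z => (orthoPoly V D n k).eval z)).re

/-- The orthonormal polynomials `p k = P k / √(h k)`. -/
def orthonormalPoly (V : ℂ → ℝ) (D : Set ℂ) (n k : ℕ) (z : ℂ) : ℂ :=
  (orthoPoly V D n k).eval z / (Real.sqrt (normConst V D n k) : ℂ)

/-- The (unnormalized) reproducing kernel. -/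
def reproducingKernel (V : ℂ → ℝ) (D : Set ℂ) (n : ℕ) (w z : ℂ) : ℂ :=
  ∑ k ∈ Finset.range n, conj (orthonormalPoly V D n k w) * orthonormalPoly V D n k z

/-- The normalized reproducing kernel. -/
def normalizedKernel (V : ℂ → ℝ) (D : Set ℂ) (n : ℕ) (w z : ℂ) : ℂ :=
  (Real.exp (-((n : ℝ) / 2) * (V w + V z)) : ℂ) * reproducingKernel V D n w z

/-- The `m`-point correlation function. -/
def correlation (V : ℂ → ℝ) (D : Set ℂ) (n m : ℕ) (z : Fin m → ℂ) : ℂ :=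
  Matrix.det (Matrix.of fun k l : Fin m => normalizedKernel V D n (z k) (z l))

/-- The pure Gaussian potential `V z = |z|²`. -/
def gaussianPotential (z : ℂ) : ℝ := ‖z‖ ^ 2

/-- The complex complementary error function `(2 / √π) ∫_z^∞ exp (-w²) dw`, with the integral
taken along the horizontal half-line `w = z + t`, `t ≥ 0`. -/
def erfc (z : ℂ) : ℂ :=
  (2 / Real.sqrt Real.pi : ℂ) * ∫ t in Set.Ioi (0 : ℝ), Complex.exp (-(z + (t : ℂ)) ^ 2)

end NormalMatrixModel

end

noncomputable section

namespace NormalMatrixModel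

/-! The weight is rotation invariant, so the monomials are the orthogonal polynomials, and the
kernel is a Gaussian prefactor times the truncated exponential `expSum n` at `n * (conj w * z)`. At
points `z₀ + a / √n` this prefactor splits into `ginibreFactor`, the factor `exp (-x)` with `x = n *
(conj w * z)`, and unimodular phases which cancel in the determinant
(`correlation_gaussian_div_eq`). The bulk and edge limits thus concern `Q n x = exp (-x) * expSum n
x`; the exterior needs only absolute values.

Where `x / n` tends to a real limit other than 1, Chernoff bounds on the exponential series decide:
`Q → 1` below 1, and the majorant of the kernel tends to 0 above 1. At the edge `x = n + √n s`, the
derivative of `Q` is minus a Gamma density. By Stirling and a Taylor expansion of the logarithm its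
rescaling tends to a Gaussian, and integrating along a horizontal ray gives `erfc (s / √2) / 2`
(`tendsto_exp_neg_mul_expSum_edge`); a bound uniform in `n` controls the far end of the ray. -/

/-! ### Gaussian moments of monomials. -/

theorem integral_norm_pow_mul_exp_neg_mul_sq {r : ℝ} (hr : 0 < r) (k : ℕ) :
    ∫ z : ℂ, ‖z‖ ^ (2 * k) * Real.exp (-r * ‖z‖ ^ 2)
      = Real.pi * k.factorial / r ^ (k + 1) := by
  have h := Complex.integral_rpow_mul_exp_neg_mul_rpow (p := 2) (q := (2 * k : ℕ)) (b := r)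
    (by norm_num) (by have : (0 : ℝ) ≤ (2 * k : ℕ) := by positivity
                      linarith) hr
  have e1 : (((2 * k : ℕ) : ℝ) + 2) / 2 = (k : ℝ) + 1 := by push_cast; ring
  have e2 : -(((2 * k : ℕ) : ℝ) + 2) / 2 = -((k + 1 : ℕ) : ℝ) := by push_cast; ring
  rw [e1, e2, Real.Gamma_nat_eq_factorial, Real.rpow_neg hr.le, Real.rpow_natCast] at h
  simp only [Real.rpow_natCast, Real.rpow_two] at h
  rw [h]
  field_simp

/-- A non-integrable function would have integral 0, whereas the value is positive. -/
theorem integrable_norm_pow_mul_exp_neg_mul_sq {r : ℝ} (hr : 0 < r) (k : ℕ) :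
    Integrable fun z : ℂ => ‖z‖ ^ (2 * k) * Real.exp (-r * ‖z‖ ^ 2) := by
  refine not_imp_comm.1 integral_undef ?_
  rw [integral_norm_pow_mul_exp_neg_mul_sq hr]
  positivity

theorem integrable_conj_pow_mul_pow_mul_exp {r : ℝ} (hr : 0 < r) (k l : ℕ) :
    Integrable fun z : ℂ => conj (z ^ k) * z ^ l * (Real.exp (-r * ‖z‖ ^ 2) : ℂ) := by
  refine ((integrable_norm_pow_mul_exp_neg_mul_sq hr k).add
    (integrable_norm_pow_mul_exp_neg_mul_sq hr l)).mono' (by fun_prop) (ae_of_all _ fun z => ?_)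
  simp only [norm_mul, RCLike.norm_conj, norm_pow, Pi.add_apply]
  rw [Complex.norm_of_nonneg (Real.exp_pos _).le, ← add_mul]
  gcongr
  rw [pow_mul', pow_mul']
  nlinarith [sq_nonneg (‖z‖ ^ k - ‖z‖ ^ l), sq_nonneg (‖z‖ ^ k + ‖z‖ ^ l)]

theorem integral_conj_pow_mul_pow_mul_exp {r : ℝ} (hr : 0 < r) (k l : ℕ) :
    ∫ z : ℂ, conj (z ^ k) * z ^ l * (Real.exp (-r * ‖z‖ ^ 2) : ℂ)
      = if k = l then ((Real.pi * k.factorial / r ^ (k + 1) : ℝ) : ℂ) else 0 := by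
  split_ifs with h
  · subst h
    rw [← integral_norm_pow_mul_exp_neg_mul_sq hr, ← integral_complex_ofReal]
    congr 1 with z
    push_cast
    rw [Complex.conj_mul', norm_pow]
    push_cast
    ring
  · set J := ∫ z : ℂ, conj (z ^ k) * z ^ l * (Real.exp (-r * ‖z‖ ^ 2) : ℂ) with hJ
    have key : ∀ u : Circle, J = conj (u : ℂ) ^ k * (u : ℂ) ^ l * J := by
      intro u
      have h1 := (rotation u).measurePreserving.integral_comp
        (rotation u).toHomeomorph.measurableEmbedding
        (fun z : ℂ => conj (z ^ k) * z ^ l * (Real.exp (-r * ‖z‖ ^ 2) : ℂ))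
      refine h1.symm.trans ?_
      rw [hJ, ← integral_const_mul]
      congr 1 with z
      simp only [rotation_apply, norm_mul, Circle.norm_coe, one_mul, mul_pow, map_mul, map_pow]
      ring
    -- Rotation by one radian serves all `k ≠ l` at once: if `exp (i (l - k))` were 1, `π` would be
    -- rational.
    have h2 := key (Circle.exp 1)
    have h3 : conj (Circle.exp 1 : ℂ) ^ k * (Circle.exp 1 : ℂ) ^ l ≠ 1 := by
      rw [Circle.coe_exp, ← Complex.exp_conj, ← Complex.exp_nat_mul, ← Complex.exp_nat_mul,
        ← Complex.exp_add]
      intro h4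
      obtain ⟨N, hN⟩ := Complex.exp_eq_one_iff.1 h4
      have h5 := congrArg Complex.im hN
      simp at h5
      have h6 : ((l : ℝ) - k) = N * (2 * Real.pi) := by linarith
      by_cases hN0 : N = 0
      · subst hN0
        apply h
        have : (l : ℝ) = k := by simpa [sub_eq_zero] using h6
        exact_mod_cast this.symm
      · apply irrational_pi
        refine ⟨((l : ℚ) - k) / (2 * N), ?_⟩
        have : (N : ℝ) ≠ 0 := by exact_mod_cast hN0
        push_cast
        rw [h6]
        field_simp
    have h7 : (conj (Circle.exp 1 : ℂ) ^ k * (Circle.exp 1 : ℂ) ^ l - 1) * J = 0 := by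
      rw [sub_mul, ← h2]; ring
    exact (mul_eq_zero.1 h7).resolve_left (sub_ne_zero.2 h3)

/-! ### Orthogonal polynomials and the explicit kernel. -/

theorem ip_gaussian_pow_pow {n : ℕ} (hn : 1 ≤ n) (k l : ℕ) :
    ip gaussianPotential Set.univ n (fun z => z ^ k) (fun z => z ^ l)
      = if k = l then ((Real.pi * k.factorial / (n : ℝ) ^ (k + 1) : ℝ) : ℂ) else 0 := by
  rw [← integral_conj_pow_mul_pow_mul_exp (by exact_mod_cast hn), ip, Measure.restrict_univ]
  rfl

theorem ip_gaussian_pow_eval {n : ℕ} (hn : 1 ≤ n) (j : ℕ) (p : Polynomial ℂ) :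
    ip gaussianPotential Set.univ n (fun z => z ^ j) (fun z => p.eval z)
      = p.coeff j * ((Real.pi * j.factorial / (n : ℝ) ^ (j + 1) : ℝ) : ℂ) := by
  have hr : (0 : ℝ) < n := by exact_mod_cast hn
  have h1 : ∀ z : ℂ, conj (z ^ j) * p.eval z * (Real.exp (-(n : ℝ) * gaussianPotential z) : ℂ)
      = ∑ i ∈ p.support,
        p.coeff i * (conj (z ^ j) * z ^ i * (Real.exp (-(n : ℝ) * ‖z‖ ^ 2) : ℂ)) := by
    intro z
    rw [Polynomial.eval_eq_sum, Polynomial.sum, Finset.mul_sum, Finset.sum_mul]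
    refine Finset.sum_congr rfl fun i _ => ?_
    rw [gaussianPotential]
    ring
  simp only [ip, Measure.restrict_univ, h1]
  rw [integral_finsetSum _ fun i _ => (integrable_conj_pow_mul_pow_mul_exp hr j i).const_mul _]
  simp only [integral_const_mul, integral_conj_pow_mul_pow_mul_exp hr, mul_ite, mul_zero]
  rw [Finset.sum_ite_eq]
  split_ifs with h
  · rfl
  · rw [Polynomial.notMem_support_iff.1 h, zero_mul]

theorem isOrthogonalFamily_X_pow {n : ℕ} (hn : 1 ≤ n) :
    IsOrthogonalFamily gaussianPotential Set.univ n fun k => Polynomial.X ^ k where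
  monic k := Polynomial.monic_X_pow k
  natDegree_eq k := Polynomial.natDegree_X_pow k
  integrable k l := by
    simpa [gaussianPotential] using
      integrable_conj_pow_mul_pow_mul_exp (r := n) (by exact_mod_cast hn) k l
  orthogonal := by
    refine ⟨fun k => Real.pi * k.factorial / (n : ℝ) ^ (k + 1), fun k => ?_, fun k l => ?_⟩
    · have : (0 : ℝ) < n := by exact_mod_cast hn
      positivity
    · simpa using ip_gaussian_pow_pow hn k l

/-- Needed because `orthoPoly` is an arbitrary choice. Inductively the lower members are monomials,
and orthogonality to `X ^ j` kills the coefficient of degree `j`. -/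
theorem IsOrthogonalFamily.eq_X_pow {n : ℕ} (hn : 1 ≤ n) {P : ℕ → Polynomial ℂ}
    (hP : IsOrthogonalFamily gaussianPotential Set.univ n P) (k : ℕ) :
    P k = Polynomial.X ^ k := by
  have hr : (0 : ℝ) < n := by exact_mod_cast hn
  obtain ⟨h, -, hh⟩ := hP.orthogonal
  induction k using Nat.strong_induction_on with
  | _ k ih =>
    ext j
    rw [Polynomial.coeff_X_pow]
    rcases lt_trichotomy j k with hj | hj | hj
    · have h1 := hh j k
      rw [ih j hj, if_neg hj.ne] at h1
      simp only [Polynomial.eval_pow, Polynomial.eval_X] at h1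
      rw [ip_gaussian_pow_eval hn] at h1
      rw [if_neg hj.ne]
      refine (mul_eq_zero.1 h1).resolve_right ?_
      norm_cast
      positivity
    · subst hj
      have h1 := hP.monic j
      rw [Polynomial.Monic, Polynomial.leadingCoeff, hP.natDegree_eq] at h1
      rw [h1, if_pos rfl]
    · rw [if_neg hj.ne', Polynomial.coeff_eq_zero_of_natDegree_lt]
      rwa [hP.natDegree_eq]

theorem orthoPoly_gaussian {n : ℕ} (hn : 1 ≤ n) (k : ℕ) :
    orthoPoly gaussianPotential Set.univ n k = Polynomial.X ^ k := by
  have h : ∃ P, IsOrthogonalFamily gaussianPotential Set.univ n P :=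
    ⟨_, isOrthogonalFamily_X_pow hn⟩
  rw [orthoPoly, dif_pos h]
  exact h.choose_spec.eq_X_pow hn k

theorem normConst_gaussian {n : ℕ} (hn : 1 ≤ n) (k : ℕ) :
    normConst gaussianPotential Set.univ n k = Real.pi * k.factorial / (n : ℝ) ^ (k + 1) := by
  simp only [normConst, orthoPoly_gaussian hn, Polynomial.eval_pow, Polynomial.eval_X]
  rw [ip_gaussian_pow_pow hn, if_pos rfl, Complex.ofReal_re]

/-- The truncated exponential series `∑_{k < n} x ^ k / k!`. -/
def expSum (n : ℕ) (x : ℂ) : ℂ := ∑ k ∈ Finset.range n, x ^ k / k.factorial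

theorem normalizedKernel_gaussian {n : ℕ} (hn : 1 ≤ n) (w z : ℂ) :
    normalizedKernel gaussianPotential Set.univ n w z
      = n / Real.pi * (Real.exp (-((n : ℝ) / 2) * (‖w‖ ^ 2 + ‖z‖ ^ 2)) : ℂ)
        * expSum n (n * (conj w * z)) := by
  have hr : (0 : ℝ) < n := by exact_mod_cast hn
  have hn' : (n : ℂ) ≠ 0 := by exact_mod_cast hr.ne'
  have hpi : (Real.pi : ℂ) ≠ 0 := by exact_mod_cast Real.pi_ne_zero
  have h1 : reproducingKernel gaussianPotential Set.univ n w z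
      = n / Real.pi * expSum n (n * (conj w * z)) := by
    rw [reproducingKernel, expSum, Finset.mul_sum]
    refine Finset.sum_congr rfl fun k _ => ?_
    simp only [orthonormalPoly, orthoPoly_gaussian hn, normConst_gaussian hn, map_div₀,
      Complex.conj_ofReal, Polynomial.eval_pow, Polynomial.eval_X]
    rw [div_mul_div_comm, ← Complex.ofReal_mul, Real.mul_self_sqrt (by positivity)]
    have : (k.factorial : ℂ) ≠ 0 := by exact_mod_cast k.factorial_ne_zero
    push_cast
    rw [map_pow]
    field_simp
    ring
  rw [normalizedKernel, h1]
  simp only [gaussianPotential]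
  ring

/-! ### The truncated exponential away from the edge. -/

theorem norm_expSum_le (n : ℕ) (x : ℂ) :
    ‖expSum n x‖ ≤ ∑ k ∈ Finset.range n, ‖x‖ ^ k / k.factorial := by
  refine (norm_sum_le _ _).trans_eq (Finset.sum_congr rfl fun k _ => ?_)
  rw [norm_div, norm_pow, Complex.norm_natCast]

/-- Chernoff bound: `t ^ n ≤ t ^ k` for every index `k < n` that occurs. -/
theorem pow_mul_sum_range_pow_div_factorial_le {y t : ℝ} (hy : 0 ≤ y) (ht0 : 0 ≤ t)
    (ht1 : t ≤ 1) (n : ℕ) :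
    t ^ n * ∑ k ∈ Finset.range n, y ^ k / k.factorial ≤ Real.exp (t * y) := by
  refine le_trans ?_ (Real.sum_le_exp_of_nonneg (mul_nonneg ht0 hy) n)
  rw [Finset.mul_sum]
  refine Finset.sum_le_sum fun k hk => ?_
  rw [mul_pow, mul_div_assoc]
  exact mul_le_mul_of_nonneg_right
    (pow_le_pow_of_le_one ht0 ht1 (Finset.mem_range.1 hk).le) (by positivity)

/-- The dual Chernoff bound: `T ^ n ≤ T ^ k` on the tail `k ≥ n`, applied to finite pieces of the
series before passing to the limit. -/
theorem pow_mul_norm_exp_sub_expSum_le {T : ℝ} (hT : 1 ≤ T) (n : ℕ) (x : ℂ) :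
    T ^ n * ‖Complex.exp x - expSum n x‖ ≤ Real.exp (T * ‖x‖) := by
  have hlim : Tendsto (fun N => expSum N x) atTop (𝓝 (Complex.exp x)) := by
    rw [Complex.exp_eq_exp_ℂ]
    exact (NormedSpace.expSeries_div_hasSum_exp x).tendsto_sum_nat
  refine le_of_tendsto ((hlim.sub_const (expSum n x)).norm.const_mul (T ^ n)) ?_
  filter_upwards [eventually_ge_atTop n] with N hN
  have h0 : 0 ≤ T := by linarith
  refine le_trans ?_ (Real.sum_le_exp_of_nonneg (mul_nonneg h0 (norm_nonneg x)) N)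
  rw [expSum, expSum, ← Finset.sum_Ico_eq_sub _ hN]
  calc T ^ n * ‖∑ k ∈ Finset.Ico n N, x ^ k / k.factorial‖
      ≤ T ^ n * ∑ k ∈ Finset.Ico n N, ‖x‖ ^ k / k.factorial := by
        gcongr
        refine (norm_sum_le _ _).trans_eq (Finset.sum_congr rfl fun k _ => ?_)
        rw [norm_div, norm_pow, Complex.norm_natCast]
    _ ≤ ∑ k ∈ Finset.Ico n N, (T * ‖x‖) ^ k / k.factorial := by
        rw [Finset.mul_sum]
        refine Finset.sum_le_sum fun k hk => ?_
        rw [mul_pow, mul_div_assoc]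
        exact mul_le_mul_of_nonneg_right
          (pow_le_pow_right₀ hT (Finset.mem_Ico.1 hk).1) (by positivity)
    _ ≤ ∑ k ∈ Finset.range N, (T * ‖x‖) ^ k / k.factorial := by
        refine Finset.sum_le_sum_of_subset_of_nonneg (fun k hk => ?_) fun k _ _ => by positivity
        exact Finset.mem_range.2 (Finset.mem_Ico.1 hk).2

theorem tendsto_exp_natCast_mul_of_neg {c : ℕ → ℝ} {c₀ : ℝ} (hc : Tendsto c atTop (𝓝 c₀))
    (h : c₀ < 0) : Tendsto (fun n : ℕ => Real.exp (n * c n)) atTop (𝓝 0) :=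
  Real.tendsto_exp_atBot.comp (tendsto_natCast_atTop_atTop.atTop_mul_neg h hc)

theorem tendsto_exp_neg_mul_expSum_of_lt_one {ζ : ℕ → ℂ} {ρ : ℝ}
    (hζ : Tendsto ζ atTop (𝓝 (ρ : ℂ))) (hρ0 : 0 ≤ ρ) (hρ : ρ < 1) :
    Tendsto (fun n : ℕ => Complex.exp (-(n * ζ n)) * expSum n (n * ζ n)) atTop (𝓝 1) := by
  -- Any `T > 1` with `T * ρ < 1` works: `log T ≥ 1 - T⁻¹` then makes the exponential rate negative.
  set T := 2 / (1 + ρ) with hT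
  have hT0 : 0 < T := by positivity
  have hT1 : 1 < T := by rw [hT, lt_div_iff₀ (by positivity)]; linarith
  have hTρ : T * ρ < 1 := by rw [hT, div_mul_eq_mul_div, div_lt_one (by positivity)]; linarith
  have hc : Tendsto (fun n => -(ζ n).re - Real.log T + T * ‖ζ n‖) atTop
      (𝓝 (-(ρ : ℂ).re - Real.log T + T * ‖(ρ : ℂ)‖)) :=
    ((((Complex.continuous_re.tendsto _).comp hζ).neg).sub_const _).add (hζ.norm.const_mul T)
  rw [Complex.ofReal_re, Complex.norm_of_nonneg hρ0] at hc
  have hneg : -ρ - Real.log T + T * ρ < 0 := by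
    have h1 := Real.one_sub_inv_le_log_of_pos hT0
    have h2 : (T - 1) * ρ < 1 - T⁻¹ := by
      have : 1 - T⁻¹ = (T - 1) * T⁻¹ := by field_simp
      rw [this]
      refine mul_lt_mul_of_pos_left ?_ (by linarith)
      exact (lt_inv_mul_iff₀ hT0).2 hTρ |>.trans_eq (mul_one _)
    linarith
  rw [← tendsto_sub_nhds_zero_iff]
  refine squeeze_zero_norm (fun n => ?_) (tendsto_exp_natCast_mul_of_neg hc hneg)
  have h1 := pow_mul_norm_exp_sub_expSum_le hT1.le n (n * ζ n)
  have h2 : Complex.exp (-(n * ζ n)) * expSum n (n * ζ n) - 1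
      = -(Complex.exp (-(n * ζ n)) * (Complex.exp (n * ζ n) - expSum n (n * ζ n))) := by
    rw [mul_sub, ← Complex.exp_add, neg_add_cancel, Complex.exp_zero]; ring
  rw [h2, norm_neg, norm_mul, Complex.norm_exp]
  have h3 : (n : ℝ) * (-(ζ n).re - Real.log T + T * ‖ζ n‖)
      = (-(n * ζ n)).re + (-(n * Real.log T) + T * ‖(n : ℂ) * ζ n‖) := by
    simp; ring
  rw [h3, Real.exp_add, Real.exp_add]
  gcongr
  rw [Real.exp_neg, ← Real.log_pow, Real.exp_log (by positivity), ← div_eq_inv_mul,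
    le_div_iff₀ (by positivity), mul_comm]
  exact h1

theorem tendsto_exp_neg_mul_sum_of_one_lt {η : ℕ → ℝ} {ρ : ℝ}
    (hη : Tendsto η atTop (𝓝 ρ)) (hη0 : ∀ n, 0 ≤ η n) (hρ : 1 < ρ) :
    Tendsto (fun n : ℕ => Real.exp (-(n * η n)) *
      ∑ k ∈ Finset.range n, (n * η n) ^ k / k.factorial) atTop (𝓝 0) := by
  -- Here `t` must lie strictly between `ρ⁻¹` and 1.
  set t := 2 / (1 + ρ) with ht
  have ht0 : 0 < t := by positivity
  have ht1 : t < 1 := by rw [ht, div_lt_one (by positivity)]; linarith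
  have htρ : 1 < t * ρ := by rw [ht, div_mul_eq_mul_div, lt_div_iff₀ (by positivity)]; linarith
  have hc : Tendsto (fun n => -η n - Real.log t + t * η n) atTop
      (𝓝 (-ρ - Real.log t + t * ρ)) := (hη.neg.sub_const _).add (hη.const_mul t)
  have hneg : -ρ - Real.log t + t * ρ < 0 := by
    have h1 := Real.one_sub_inv_le_log_of_pos ht0
    have h2 : t⁻¹ < ρ := by rw [inv_lt_iff_one_lt_mul₀ ht0, mul_comm]; linarith
    have h3 : 1 - t⁻¹ = (t - 1) * t⁻¹ := by field_simp
    nlinarith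
  refine squeeze_zero (fun n => ?_) (fun n => ?_) (tendsto_exp_natCast_mul_of_neg hc hneg)
  · have := hη0 n
    positivity
  · have h1 := pow_mul_sum_range_pow_div_factorial_le
      (mul_nonneg n.cast_nonneg (hη0 n)) ht0.le ht1.le n
    have h3 : (n : ℝ) * (-η n - Real.log t + t * η n)
        = -(n * η n) + (-(n * Real.log t) + t * (n * η n)) := by ring
    rw [h3, Real.exp_add, Real.exp_add]
    gcongr
    rw [Real.exp_neg, ← Real.log_pow, Real.exp_log (by positivity), ← div_eq_inv_mul,
      le_div_iff₀ (by positivity), mul_comm]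
    exact h1

/-! ### Uniform tail bound at the edge scale. -/

theorem exp_neg_le_one_sub_add_sq_div_two {h : ℝ} (hh : 0 ≤ h) :
    Real.exp (-h) ≤ 1 - h + h ^ 2 / 2 := by
  rw [Real.exp_neg, inv_le_iff_one_le_mul₀ (Real.exp_pos h)]
  have h1 := Real.quadratic_le_exp_of_nonneg hh
  have h2 : 0 ≤ 1 - h + h ^ 2 / 2 := by nlinarith [sq_nonneg (h - 1)]
  nlinarith [mul_le_mul_of_nonneg_left h1 h2, sq_nonneg (h ^ 2)]

/-- The Chernoff bound with `t = exp (-1 / √n)`: the cost `t ^ (-n) = exp √n` is cancelled by the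
leading gain, leaving a bound free of `n`. -/
theorem exp_neg_mul_sum_le {n : ℕ} (hn : 1 ≤ n) {R y : ℝ} (hR : 0 ≤ R)
    (hy : n + Real.sqrt n * R ≤ y) :
    Real.exp (-y) * ∑ k ∈ Finset.range n, y ^ k / k.factorial ≤ Real.exp ((1 - R) / 2) := by
  have hn' : (1 : ℝ) ≤ n := by exact_mod_cast hn
  have hs : 1 ≤ Real.sqrt n := Real.one_le_sqrt.2 hn'
  have hsq : Real.sqrt n ^ 2 = n := Real.sq_sqrt (by positivity)
  set q := Real.sqrt n with hq
  have hq0 : 0 < q := by linarith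
  have hy0 : 0 ≤ y := le_trans (by positivity) hy
  have h1 := pow_mul_sum_range_pow_div_factorial_le hy0 (Real.exp_pos (-(1 / q))).le
    (Real.exp_le_one_iff.2 (by simp [hq0.le])) n
  have h2 := exp_neg_le_one_sub_add_sq_div_two (h := 1 / q) (by positivity)
  rw [← Real.exp_nat_mul, ← le_div_iff₀' (Real.exp_pos _), ← Real.exp_sub] at h1
  refine (mul_le_mul_of_nonneg_left h1 (Real.exp_pos _).le).trans ?_
  rw [← Real.exp_add, Real.exp_le_exp]
  have h3 : (n : ℝ) * -(1 / q) = -q := by rw [← hsq]; field_simp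
  have h4 : Real.exp (-(1 / q)) * y ≤ (1 - 1 / q + (1 / q) ^ 2 / 2) * y := by gcongr
  have h5 : (1 / q - (1 / q) ^ 2 / 2) * (q ^ 2 + q * R)
      ≤ (1 / q - (1 / q) ^ 2 / 2) * y := by
    refine mul_le_mul_of_nonneg_left (by linarith) ?_
    have : 1 / q ≤ 1 := by rw [div_le_one hq0]; exact hs
    have : 0 < 1 / q := by positivity
    nlinarith
  have h6 : (1 / q - (1 / q) ^ 2 / 2) * (q ^ 2 + q * R)
      = q + R - 1 / 2 - R * (1 / q) / 2 := by field_simp; ring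
  have h7 : R * (1 / q) ≤ R := by
    refine mul_le_of_le_one_right hR ?_
    rw [div_le_one hq0]; exact hs
  rw [h3]
  linarith

/-- Replacing `x.re` by `‖x‖` in the exponential costs at most `exp (M ^ 2)`, since `x.re ≥ n` and
`|x.im| ≤ √n M`. -/
theorem norm_exp_neg_mul_expSum_le {n : ℕ} (hn : 1 ≤ n) {M R : ℝ} {s : ℂ} (hs : ‖s‖ ≤ M)
    (hR : M ≤ R) :
    ‖Complex.exp (-(n + Real.sqrt n * (s + R))) * expSum n (n + Real.sqrt n * (s + R))‖
      ≤ Real.exp (M ^ 2 + (1 - (R - M)) / 2) := by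
  have hn' : (1 : ℝ) ≤ n := by exact_mod_cast hn
  have hq0 : 0 < Real.sqrt n := by positivity
  have hsq : Real.sqrt n ^ 2 = n := Real.sq_sqrt (by positivity)
  set q := Real.sqrt n with hq
  set x : ℂ := n + q * (s + R) with hx
  have hM0 : 0 ≤ M := (norm_nonneg s).trans hs
  have hre : x.re = n + q * (s.re + R) := by simp [hx]
  have him : x.im = q * s.im := by simp [hx]
  have hsre := (abs_le.1 ((Complex.abs_re_le_norm s).trans hs)).1
  have hsim := (Complex.abs_im_le_norm s).trans hs
  have hre1 : n + q * (R - M) ≤ x.re := by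
    rw [hre]
    gcongr
    linarith
  have hre2 : (n : ℝ) ≤ x.re := le_trans (by nlinarith) hre1
  have hnorm : ‖x‖ ≤ x.re + M ^ 2 := by
    refine (abs_le_of_sq_le_sq' ?_ (by nlinarith [sq_nonneg M])).2
    rw [Complex.sq_norm, Complex.normSq_apply, him]
    have : s.im ^ 2 ≤ M ^ 2 := sq_le_sq' (by linarith [(abs_le.1 hsim).1]) (abs_le.1 hsim).2
    nlinarith [sq_nonneg (M ^ 2), mul_le_mul_of_nonneg_left this (by linarith : (0 : ℝ) ≤ n),
      mul_le_mul_of_nonneg_right hre2 (sq_nonneg M), sq_nonneg M]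
  have h1 := exp_neg_mul_sum_le hn (R := R - M) (y := ‖x‖) (by linarith)
    (hre1.trans (Complex.re_le_norm x))
  rw [norm_mul, Complex.norm_exp, Complex.neg_re]
  have h2 : Real.exp (-x.re) ≤ Real.exp (M ^ 2) * Real.exp (-‖x‖) := by
    rw [← Real.exp_add, Real.exp_le_exp]
    linarith
  rw [Real.exp_add]
  calc Real.exp (-x.re) * ‖expSum n x‖
      ≤ (Real.exp (M ^ 2) * Real.exp (-‖x‖)) *
        ∑ k ∈ Finset.range n, ‖x‖ ^ k / k.factorial := by
        gcongr
        exact norm_expSum_le n x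
    _ ≤ _ := by
        rw [mul_assoc]
        gcongr

/-! ### The Gamma density and its Gaussian limit. -/

theorem hasDerivAt_exp_neg_mul_expSum {n : ℕ} (hn : 1 ≤ n) (x : ℂ) :
    HasDerivAt (fun x => Complex.exp (-x) * expSum n x)
      (-(Complex.exp (-x) * (x ^ (n - 1) / (n - 1).factorial))) x := by
  have he : HasDerivAt (fun x : ℂ => Complex.exp (-x)) (-Complex.exp (-x)) x := by
    simpa using (hasDerivAt_neg x).cexp
  induction n, hn using Nat.le_induction with
  | base =>
    simpa [expSum] using he
  | succ n hn ih =>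
    have h1 : (fun x => Complex.exp (-x) * expSum (n + 1) x)
        = fun x => Complex.exp (-x) * expSum n x + Complex.exp (-x) * (x ^ n / n.factorial) := by
      funext x
      rw [expSum, Finset.sum_range_succ, mul_add, expSum]
    rw [h1]
    refine (ih.add (he.mul ((hasDerivAt_pow n x).div_const _))).congr_deriv ?_
    have h2 : (n.factorial : ℂ) = n * (n - 1).factorial := by
      exact_mod_cast (Nat.mul_factorial_pred (by omega)).symm
    have h3 : (n : ℂ) ≠ 0 := by exact_mod_cast (by omega : n ≠ 0)
    have h4 : ((n - 1).factorial : ℂ) ≠ 0 := by exact_mod_cast (n - 1).factorial_ne_zero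
    rw [Nat.add_sub_cancel, h2]
    field_simp
    ring

/-- The rescaled Gamma density `√n e^{-x} x ^ (n - 1) / (n - 1)!` at `x = n + √n r`. -/
def scaledGammaDensity (n : ℕ) (r : ℂ) : ℂ :=
  Real.sqrt n * (Complex.exp (-(n + Real.sqrt n * r)) *
    ((n + Real.sqrt n * r) ^ (n - 1) / (n - 1).factorial))

theorem scaledGammaDensity_eq {n : ℕ} (hn : 1 ≤ n) (r : ℂ) :
    scaledGammaDensity n r = ((1 / (Real.sqrt 2 * Stirling.stirlingSeq n) : ℝ) : ℂ) *
      (Complex.exp (-(n * (r / Real.sqrt n))) * (1 + r / Real.sqrt n) ^ (n - 1)) := by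
  obtain ⟨k, rfl⟩ : ∃ k, n = k + 1 := ⟨n - 1, by omega⟩
  have hn' : (0 : ℝ) < (k + 1 : ℕ) := by positivity
  have hq0 : 0 < Real.sqrt (k + 1 : ℕ) := by positivity
  have hsq : Real.sqrt (k + 1 : ℕ) ^ 2 = (k + 1 : ℕ) := Real.sq_sqrt (by positivity)
  rw [scaledGammaDensity, Stirling.stirlingSeq, Real.sqrt_mul (by norm_num)]
  set q := Real.sqrt (k + 1 : ℕ) with hq
  have hq0' : (q : ℂ) ≠ 0 := by exact_mod_cast hq0.ne'
  have hsq' : ((k + 1 : ℕ) : ℂ) = q ^ 2 := by exact_mod_cast hsq.symm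
  have h2 : Real.sqrt 2 * Real.sqrt 2 = 2 := Real.mul_self_sqrt (by norm_num)
  have h3 : (1 / (Real.sqrt 2 * ((k + 1).factorial /
      (Real.sqrt 2 * q * ((k + 1 : ℕ) / Real.exp 1) ^ (k + 1)))) : ℝ)
      = q * (q ^ 2) ^ k * Real.exp (-(q ^ 2)) / k.factorial := by
    have h4 : Real.exp 1 ^ (k + 1) = Real.exp (q ^ 2) := by
      rw [← Real.exp_nat_mul, mul_one, hsq]
    rw [div_pow, h4, Nat.factorial_succ, Nat.cast_mul, Real.exp_neg, ← hsq]
    have : (k.factorial : ℝ) ≠ 0 := by exact_mod_cast k.factorial_ne_zero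
    field_simp
    ring
  rw [h3, Nat.add_sub_cancel, hsq']
  have h5 : (q : ℂ) ^ 2 + q * r = q ^ 2 * (1 + r / q) := by field_simp
  have h6 : Complex.exp (-((q : ℂ) ^ 2 + q * r))
      = Complex.exp (-(q : ℂ) ^ 2) * Complex.exp (-(q ^ 2 * (r / q))) := by
    rw [← Complex.exp_add]
    congr 1
    field_simp
    ring
  rw [h6, h5, mul_pow]
  push_cast
  ring

/-- `‖1 + w‖ ^ 2 ≤ exp (2 * w.re + ‖w‖ ^ 2)` makes the linear terms cancel, up to one stray `w.re`
due to the power `n - 1`. -/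
theorem norm_exp_neg_mul_one_add_pow_le {n : ℕ} (hn : 1 ≤ n) (w : ℂ) :
    ‖Complex.exp (-(n * w)) * (1 + w) ^ (n - 1)‖ ≤ Real.exp (‖w‖ + n * ‖w‖ ^ 2 / 2) := by
  obtain ⟨k, rfl⟩ : ∃ k, n = k + 1 := ⟨n - 1, by omega⟩
  have h1 : ‖1 + w‖ ≤ Real.exp (w.re + ‖w‖ ^ 2 / 2) := by
    refine (abs_le_of_sq_le_sq' ?_ (Real.exp_pos _).le).2
    have h2 : ‖1 + w‖ ^ 2 = 1 + (2 * w.re + ‖w‖ ^ 2) := by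
      rw [Complex.sq_norm, Complex.sq_norm, Complex.normSq_apply, Complex.normSq_apply]
      simp
      ring
    rw [h2, ← Real.exp_nat_mul]
    have := Real.add_one_le_exp (2 * w.re + ‖w‖ ^ 2)
    refine le_trans (by linarith) (this.trans_eq ?_)
    congr 1
    push_cast
    ring
  rw [norm_mul, Complex.norm_exp, norm_pow, Nat.add_sub_cancel]
  calc Real.exp (-(((k + 1 : ℕ) : ℂ) * w)).re * ‖1 + w‖ ^ k
      ≤ Real.exp (-(((k + 1 : ℕ) : ℂ) * w)).re * Real.exp (w.re + ‖w‖ ^ 2 / 2) ^ k := by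
        gcongr
    _ ≤ _ := by
        rw [← Real.exp_nat_mul, ← Real.exp_add, Real.exp_le_exp]
        have h3 := (abs_le.1 (Complex.abs_re_le_norm w)).1
        have h4 : (-(((k + 1 : ℕ) : ℂ) * w)).re = -((k + 1) * w.re) := by simp
        rw [h4]
        push_cast
        nlinarith [sq_nonneg ‖w‖]

theorem norm_scaledGammaDensity_le {n : ℕ} (hn : 1 ≤ n) {M : ℝ} {r : ℂ} (hr : ‖r‖ ≤ M) :
    ‖scaledGammaDensity n r‖ ≤ Real.exp (M + M ^ 2 / 2) := by
  have hn' : (1 : ℝ) ≤ n := by exact_mod_cast hn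
  have hq : 1 ≤ Real.sqrt n := Real.one_le_sqrt.2 hn'
  have hq0 : 0 < Real.sqrt n := by linarith
  have hsq : Real.sqrt n ^ 2 = n := Real.sq_sqrt (by positivity)
  rw [scaledGammaDensity_eq hn, norm_mul]
  have h1 : ‖((1 / (Real.sqrt 2 * Stirling.stirlingSeq n) : ℝ) : ℂ)‖ ≤ 1 := by
    have h2 := Stirling.sqrt_pi_le_stirlingSeq (n := n) (by omega)
    have h3 : 1 ≤ Real.sqrt Real.pi := Real.one_le_sqrt.2 (by linarith [Real.pi_gt_three])
    have h4 : 1 ≤ Real.sqrt 2 := Real.one_le_sqrt.2 (by norm_num)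
    have h5 : 1 ≤ Real.sqrt 2 * Stirling.stirlingSeq n := by nlinarith
    rw [Complex.norm_of_nonneg (by positivity), div_le_one (by positivity)]
    exact h5
  refine (mul_le_mul h1 (norm_exp_neg_mul_one_add_pow_le hn _) (norm_nonneg _)
    zero_le_one).trans ?_
  rw [one_mul, Real.exp_le_exp, norm_div, Complex.norm_of_nonneg hq0.le]
  have h6 : ‖r‖ / Real.sqrt n ≤ M := (div_le_self (norm_nonneg r) hq).trans hr
  have h7 : n * (‖r‖ / Real.sqrt n) ^ 2 = ‖r‖ ^ 2 := by
    rw [div_pow, hsq]; field_simp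
  rw [h7]
  gcongr

theorem tendsto_div_sqrt_natCast {r : ℕ → ℂ} {r₀ : ℂ} (hr : Tendsto r atTop (𝓝 r₀)) :
    Tendsto (fun n : ℕ => r n / Real.sqrt n) atTop (𝓝 0) := by
  have h : Tendsto (fun n : ℕ => ((Real.sqrt n)⁻¹ : ℝ)) atTop (𝓝 0) :=
    tendsto_inv_atTop_zero.comp (Real.tendsto_sqrt_atTop.comp tendsto_natCast_atTop_atTop)
  have h2 := hr.mul ((Complex.continuous_ofReal.tendsto _).comp h)
  simpa [div_eq_mul_inv, Function.comp_def] using h2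

/-- With `w = r / √n`, `n * w ^ 2 = r ^ 2` while the cubic remainder of `log (1 + w)` contributes
`O(n ‖w‖ ^ 3) → 0`. The power `n - 1` instead of `n` only costs a factor `1 + w → 1`. -/
theorem tendsto_exp_neg_mul_one_add_pow {r : ℕ → ℂ} {r₀ : ℂ} (hr : Tendsto r atTop (𝓝 r₀)) :
    Tendsto (fun n : ℕ => Complex.exp (-(n * (r n / Real.sqrt n))) *
      (1 + r n / Real.sqrt n) ^ (n - 1)) atTop (𝓝 (Complex.exp (-(r₀ ^ 2) / 2))) := by
  set w : ℕ → ℂ := fun n => r n / Real.sqrt n with hw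
  have hw0 : Tendsto w atTop (𝓝 0) := tendsto_div_sqrt_natCast hr
  have hnw : ∀ᶠ n : ℕ in atTop, (n : ℂ) * w n ^ 2 = r n ^ 2 := by
    filter_upwards [eventually_ge_atTop 1] with n hn
    have hn' : (0 : ℝ) < n := by exact_mod_cast hn
    have hsq : ((Real.sqrt n : ℝ) : ℂ) ^ 2 = n := by exact_mod_cast Real.sq_sqrt hn'.le
    have : (n : ℂ) ≠ 0 := by exact_mod_cast hn'.ne'
    rw [hw]
    simp only
    rw [div_pow, hsq]
    field_simp
  have hw2 : Tendsto (fun n : ℕ => (n : ℂ) * w n ^ 2) atTop (𝓝 (r₀ ^ 2)) :=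
    (hr.pow 2).congr' (hnw.mono fun n h => h.symm)
  have hlog : Tendsto (fun n : ℕ => (n : ℂ) * (Complex.log (1 + w n) - w n + w n ^ 2 / 2))
      atTop (𝓝 0) := by
    have hb : Tendsto (fun n : ℕ => ‖(n : ℂ) * w n ^ 2‖ * (‖w n‖ * (1 - ‖w n‖)⁻¹ / 3))
        atTop (𝓝 0) := by
      have h1 : Tendsto (fun n => ‖w n‖) atTop (𝓝 0) := by simpa using hw0.norm
      have h2 := (h1.const_sub 1).inv₀ (by norm_num)
      have h3 := hw2.norm.mul ((h1.mul h2).div_const 3)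
      simpa using h3
    refine squeeze_zero_norm' ?_ hb
    filter_upwards [hw0.norm.eventually_lt_const (show ‖(0 : ℂ)‖ < 1 by simp)] with n hn
    have h1 := Complex.norm_log_sub_logTaylor_le 2 hn
    have h2 : Complex.logTaylor 3 (w n) = w n - w n ^ 2 / 2 := by
      simp [Complex.logTaylor, Finset.sum_range_succ]
      ring
    rw [h2] at h1
    have h3 : Complex.log (1 + w n) - w n + w n ^ 2 / 2
        = Complex.log (1 + w n) - (w n - w n ^ 2 / 2) := by ring
    rw [h3, norm_mul, norm_mul, norm_pow]
    refine (mul_le_mul_of_nonneg_left h1 (norm_nonneg _)).trans_eq ?_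
    norm_num
    ring
  have hexp : Tendsto (fun n : ℕ => (n : ℂ) * (Complex.log (1 + w n) - w n)) atTop
      (𝓝 (-(r₀ ^ 2) / 2)) := by
    have h1 := hlog.sub (hw2.div_const 2)
    rw [zero_sub, ← neg_div] at h1
    refine h1.congr fun n => ?_
    ring
  have h1w : Tendsto (fun n => 1 + w n) atTop (𝓝 1) := by simpa using hw0.const_add 1
  have hmain := ((Complex.continuous_exp.tendsto _).comp hexp).div h1w one_ne_zero
  rw [div_one] at hmain
  refine hmain.congr' ?_
  filter_upwards [h1w.eventually_ne one_ne_zero, eventually_ge_atTop 1] with n hn hn1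
  obtain ⟨k, rfl⟩ : ∃ k, n = k + 1 := ⟨n - 1, by omega⟩
  simp only [Pi.div_apply, Function.comp_apply]
  rw [mul_sub, sub_eq_neg_add, Complex.exp_add, Complex.exp_nat_mul, Complex.exp_log hn,
    Nat.add_sub_cancel, pow_succ]
  change _ = Complex.exp (-(((k + 1 : ℕ) : ℂ) * w (k + 1))) * (1 + w (k + 1)) ^ k
  generalize w (k + 1) = v at hn ⊢
  field_simp

theorem tendsto_scaledGammaDensity {r : ℕ → ℂ} {r₀ : ℂ} (hr : Tendsto r atTop (𝓝 r₀)) :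
    Tendsto (fun n => scaledGammaDensity n (r n)) atTop
      (𝓝 (((1 / Real.sqrt (2 * Real.pi) : ℝ) : ℂ) * Complex.exp (-(r₀ ^ 2) / 2))) := by
  have h1 : Tendsto (fun n => (1 / (Real.sqrt 2 * Stirling.stirlingSeq n) : ℝ)) atTop
      (𝓝 (1 / Real.sqrt (2 * Real.pi))) := by
    rw [Real.sqrt_mul (by norm_num)]
    exact tendsto_const_nhds.div (Stirling.tendsto_stirlingSeq_sqrt_pi.const_mul _) (by positivity)
  refine (((Complex.continuous_ofReal.tendsto _).comp h1).mul
    (tendsto_exp_neg_mul_one_add_pow hr)).congr' ?_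
  filter_upwards [eventually_ge_atTop 1] with n hn
  exact (scaledGammaDensity_eq hn _).symm

theorem continuous_scaledGammaDensity (n : ℕ) : Continuous (scaledGammaDensity n) := by
  unfold scaledGammaDensity
  fun_prop

theorem integral_scaledGammaDensity {n : ℕ} (hn : 1 ≤ n) (s : ℂ) (R : ℝ) :
    ∫ t in (0 : ℝ)..R, scaledGammaDensity n (s + t)
      = Complex.exp (-(n + Real.sqrt n * s)) * expSum n (n + Real.sqrt n * s)
        - Complex.exp (-(n + Real.sqrt n * (s + R))) * expSum n (n + Real.sqrt n * (s + R)) := by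
  have hd : ∀ t : ℝ, HasDerivAt (fun t : ℝ => -(Complex.exp (-(n + Real.sqrt n * (s + t))) *
      expSum n (n + Real.sqrt n * (s + t)))) (scaledGammaDensity n (s + t)) t := by
    intro t
    have h1 : HasDerivAt (fun t : ℝ => (n : ℂ) + Real.sqrt n * (s + t)) (Real.sqrt n) t := by
      simpa using (((Complex.ofRealCLM.hasDerivAt (x := t)).const_add s).const_mul
        ((Real.sqrt n : ℝ) : ℂ)).const_add (n : ℂ)
    refine ((hasDerivAt_exp_neg_mul_expSum hn _).comp t h1).neg.congr_deriv ?_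
    rw [scaledGammaDensity]
    ring
  rw [intervalIntegral.integral_eq_sub_of_hasDerivAt (fun t _ => hd t)
    (((continuous_scaledGammaDensity n).comp (by fun_prop)).intervalIntegrable _ _)]
  simp only [Complex.ofReal_zero, add_zero]
  ring

theorem tendsto_integral_scaledGammaDensity {s : ℕ → ℂ} {s₀ : ℂ} (hs : Tendsto s atTop (𝓝 s₀))
    (R : ℝ) :
    Tendsto (fun n => ∫ t in (0 : ℝ)..R, scaledGammaDensity n (s n + t)) atTop
      (𝓝 (∫ t in (0 : ℝ)..R,
        ((1 / Real.sqrt (2 * Real.pi) : ℝ) : ℂ) * Complex.exp (-((s₀ + t) ^ 2) / 2))) := by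
  set M := ‖s₀‖ + 1 + |R| with hM
  refine intervalIntegral.tendsto_integral_filter_of_dominated_convergence
    (fun _ => Real.exp (M + M ^ 2 / 2)) ?_ ?_ (by simp) ?_
  · exact Eventually.of_forall fun n =>
      ((continuous_scaledGammaDensity n).comp (by fun_prop)).aestronglyMeasurable
  · filter_upwards [eventually_ge_atTop 1,
      hs.norm.eventually_lt_const (show ‖s₀‖ < ‖s₀‖ + 1 by linarith)] with n hn hsn
    refine ae_of_all _ fun t ht => norm_scaledGammaDensity_le hn ?_
    refine (norm_add_le _ _).trans (add_le_add hsn.le ?_)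
    rw [Complex.norm_real, Real.norm_eq_abs]
    rcases Set.mem_uIoc.1 ht with h | h
    · rw [abs_of_pos h.1]; exact h.2.trans (le_abs_self R)
    · rw [abs_of_nonpos h.2]; exact (neg_le_neg h.1.le).trans (neg_le_abs R)
  · exact ae_of_all _ fun t _ => tendsto_scaledGammaDensity (hs.add_const _)

theorem integrableOn_exp_neg_sq_div_two (s : ℂ) :
    IntegrableOn (fun t : ℝ => ((1 / Real.sqrt (2 * Real.pi) : ℝ) : ℂ) *
      Complex.exp (-((s + t) ^ 2) / 2)) (Set.Ioi 0) := by
  refine Integrable.integrableOn (Integrable.const_mul ?_ _)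
  refine (integrable_cexp_quadratic (b := 1 / 2) (by norm_num) (-s) (-s ^ 2 / 2)).congr
    (ae_of_all _ fun t => ?_)
  simp only
  congr 1
  ring

theorem erfc_div_sqrt_two (s : ℂ) :
    erfc (s / Real.sqrt 2) / 2 = ∫ t in Set.Ioi (0 : ℝ),
      ((1 / Real.sqrt (2 * Real.pi) : ℝ) : ℂ) * Complex.exp (-((s + t) ^ 2) / 2) := by
  have h2 : (0 : ℝ) < Real.sqrt 2 := by positivity
  have h2' : ((Real.sqrt 2 : ℝ) : ℂ) ≠ 0 := by exact_mod_cast h2.ne'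
  have hsq : ((Real.sqrt 2 : ℝ) : ℂ) ^ 2 = 2 := by
    exact_mod_cast Real.sq_sqrt (by norm_num : (0 : ℝ) ≤ 2)
  have h := integral_comp_mul_left_Ioi
    (fun t : ℝ => Complex.exp (-((s + t) ^ 2) / 2)) 0 h2
  rw [mul_zero] at h
  have h3 : ∀ t : ℝ, Complex.exp (-(s / Real.sqrt 2 + t) ^ 2)
      = Complex.exp (-((s + (Real.sqrt 2 * t : ℝ)) ^ 2) / 2) := by
    intro t
    congr 1
    push_cast
    field_simp
    rw [hsq]
    ring
  rw [erfc, integral_const_mul]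
  simp only [h3]
  rw [h, Real.sqrt_mul (by norm_num), Complex.real_smul]
  push_cast
  field_simp

theorem tendsto_exp_neg_mul_expSum_edge {s : ℕ → ℂ} {s₀ : ℂ} (hs : Tendsto s atTop (𝓝 s₀)) :
    Tendsto (fun n : ℕ => Complex.exp (-(n + Real.sqrt n * s n)) *
      expSum n (n + Real.sqrt n * s n)) atTop (𝓝 (erfc (s₀ / Real.sqrt 2) / 2)) := by
  rw [erfc_div_sqrt_two]
  set φ : ℝ → ℂ := fun t =>
    ((1 / Real.sqrt (2 * Real.pi) : ℝ) : ℂ) * Complex.exp (-((s₀ + t) ^ 2) / 2) with hφ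
  set M := ‖s₀‖ + 1 with hM
  have hlim : Tendsto (fun R : ℝ => ∫ t in (0 : ℝ)..R, φ t) atTop
      (𝓝 (∫ t in Set.Ioi (0 : ℝ), φ t)) :=
    intervalIntegral_tendsto_integral_Ioi 0 (integrableOn_exp_neg_sq_div_two s₀) tendsto_id
  have htail : Tendsto (fun R : ℝ => Real.exp (M ^ 2 + (1 - (R - M)) / 2)) atTop (𝓝 0) := by
    refine Real.tendsto_exp_atBot.comp (tendsto_atBot_add_const_left _ _ ?_)
    refine Tendsto.atBot_div_const (by norm_num) ?_
    exact tendsto_atBot_add_const_left _ _ (tendsto_neg_atTop_atBot.comp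
      (tendsto_atTop_add_const_right _ _ tendsto_id))
  rw [Metric.tendsto_atTop']
  intro ε hε
  -- `R` is fixed first, making the Gaussian tail and the endpoint term small; the latter bound does
  -- not involve `n`, so only then is `n` taken large.
  obtain ⟨R, h1, h2, h3⟩ := ((hlim.eventually (Metric.ball_mem_nhds _ (by positivity : 0 < ε / 3))).and
    ((htail.eventually_lt_const (by positivity : 0 < ε / 3)).and (eventually_ge_atTop M))).exists
  have h4 := (tendsto_integral_scaledGammaDensity hs R).eventually
    (Metric.ball_mem_nhds _ (by positivity : 0 < ε / 3))
  obtain ⟨N, hN⟩ := eventually_atTop.1 ((h4.and (eventually_ge_atTop 1)).and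
    (hs.norm.eventually_lt_const (show ‖s₀‖ < M by linarith)))
  refine ⟨N, fun n hn => ?_⟩
  obtain ⟨⟨h5, h6⟩, h7⟩ := hN n hn.le
  have h8 := norm_exp_neg_mul_expSum_le h6 h7.le h3
  rw [integral_scaledGammaDensity h6, dist_eq_norm] at h5
  rw [dist_eq_norm] at h1 ⊢
  refine lt_of_le_of_lt (le_of_eq_of_le (congrArg norm ?_) norm_add₃_le)
    (lt_of_lt_of_eq (add_lt_add (add_lt_add h5 h1) (h8.trans_lt h2)) (by ring))
  ring

/-! ### Factoring the kernel and removing the phases. -/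

/-- The Ginibre kernel factor `exp (-|a - b|² / 2 + i Im (conj a * b))`. -/
def ginibreFactor (a b : ℂ) : ℂ :=
  Complex.exp (-(1 / 2 : ℂ) * (‖a - b‖ : ℂ) ^ 2 + Complex.I * ((conj a * b).im : ℂ))

/-- The phase `exp (i √n Im (conj z₀ * b))`. -/
def phase (n : ℕ) (z₀ b : ℂ) : ℂ :=
  Complex.exp (Complex.I * ((Real.sqrt n * (conj z₀ * b).im : ℝ) : ℂ))

theorem conj_phase_mul_phase (n : ℕ) (z₀ b : ℂ) : conj (phase n z₀ b) * phase n z₀ b = 1 := by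
  rw [phase, ← Complex.exp_conj, ← Complex.exp_add, map_mul, Complex.conj_I,
    Complex.conj_ofReal]
  simp

theorem normalizedKernel_div_eq {n : ℕ} (hn : 1 ≤ n) (z₀ a b : ℂ) :
    normalizedKernel gaussianPotential Set.univ n (z₀ + a / Real.sqrt n) (z₀ + b / Real.sqrt n) / n
      = conj (phase n z₀ a) * (phase n z₀ b * (1 / Real.pi *
        (Complex.exp (-(n * (conj (z₀ + a / Real.sqrt n) * (z₀ + b / Real.sqrt n)))) *
          expSum n (n * (conj (z₀ + a / Real.sqrt n) * (z₀ + b / Real.sqrt n)))) *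
        ginibreFactor a b)) := by
  have hr : (0 : ℝ) < n := by exact_mod_cast hn
  have hn' : (n : ℂ) ≠ 0 := by exact_mod_cast hr.ne'
  have hsq : Real.sqrt n ^ 2 = n := Real.sq_sqrt hr.le
  have hq0 : 0 < Real.sqrt n := by positivity
  rw [normalizedKernel_gaussian hn]
  set q := Real.sqrt n with hq
  have hq0' : (q : ℂ) ≠ 0 := by exact_mod_cast hq0.ne'
  have hsq' : (n : ℂ) = q ^ 2 := by exact_mod_cast hsq.symm
  have hexp : (Real.exp (-((n : ℝ) / 2) * (‖z₀ + a / q‖ ^ 2 + ‖z₀ + b / q‖ ^ 2)) : ℂ)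
      = conj (phase n z₀ a) * (phase n z₀ b *
        Complex.exp (-(n * (conj (z₀ + a / q) * (z₀ + b / q)))) * ginibreFactor a b) := by
    have him : ∀ z : ℂ, Complex.I * (z.im : ℂ) = (z - conj z) / 2 := by
      intro z
      rw [Complex.sub_conj]
      push_cast
      ring
    rw [phase, phase, ginibreFactor, ← Complex.exp_conj, ← Complex.exp_add, ← Complex.exp_add,
      ← Complex.exp_add, Complex.ofReal_exp]
    congr 1
    rw [map_mul, Complex.conj_I, Complex.conj_ofReal]
    push_cast
    simp only [← hq, neg_mul, mul_left_comm Complex.I (q : ℂ), him]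
    simp only [← Complex.conj_mul', map_add, map_sub, map_mul, map_div₀, Complex.conj_conj,
      Complex.conj_ofReal]
    rw [hsq']
    field_simp
    ring
  rw [hexp]
  field_simp

theorem correlation_div_eq (n m : ℕ) (z : Fin m → ℂ) :
    correlation gaussianPotential Set.univ n m z / (n : ℂ) ^ m
      = Matrix.det (Matrix.of fun k l : Fin m =>
        normalizedKernel gaussianPotential Set.univ n (z k) (z l) / n) := by
  have h : (Matrix.of fun k l : Fin m =>
      normalizedKernel gaussianPotential Set.univ n (z k) (z l) / (n : ℂ))
      = (n : ℂ)⁻¹ • Matrix.of fun k l : Fin m =>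
        normalizedKernel gaussianPotential Set.univ n (z k) (z l) := by
    ext k l
    simp [div_eq_inv_mul]
  rw [h, Matrix.det_smul, Fintype.card_fin, correlation, inv_pow, div_eq_inv_mul]

/-- The phases conjugate the matrix by a diagonal unitary one, which preserves the determinant. -/
theorem correlation_gaussian_div_eq {n : ℕ} (hn : 1 ≤ n) {m : ℕ} (z₀ : ℂ) (a : Fin m → ℂ) :
    correlation gaussianPotential Set.univ n m (fun k => z₀ + a k / Real.sqrt n) / (n : ℂ) ^ m
      = Matrix.det (Matrix.of fun k l : Fin m => 1 / Real.pi *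
        (Complex.exp (-(n * (conj (z₀ + a k / Real.sqrt n) * (z₀ + a l / Real.sqrt n)))) *
          expSum n (n * (conj (z₀ + a k / Real.sqrt n) * (z₀ + a l / Real.sqrt n)))) *
        ginibreFactor (a k) (a l)) := by
  rw [correlation_div_eq]
  simp only [normalizedKernel_div_eq hn]
  set A : Matrix (Fin m) (Fin m) ℂ := Matrix.of fun k l : Fin m => 1 / Real.pi *
        (Complex.exp (-(n * (conj (z₀ + a k / Real.sqrt n) * (z₀ + a l / Real.sqrt n)))) *
          expSum n (n * (conj (z₀ + a k / Real.sqrt n) * (z₀ + a l / Real.sqrt n)))) *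
        ginibreFactor (a k) (a l) with hA
  have h1 := Matrix.det_mul_column (fun k => conj (phase n z₀ (a k)))
    (Matrix.of fun k l => phase n z₀ (a l) * A k l)
  rw [Matrix.det_mul_row, ← mul_assoc, ← Finset.prod_mul_distrib] at h1
  simp only [conj_phase_mul_phase, Finset.prod_const_one, one_mul] at h1
  exact h1

theorem tendsto_det_of {m : ℕ} {A : ℕ → Fin m → Fin m → ℂ} {B : Fin m → Fin m → ℂ}
    (h : ∀ k l, Tendsto (fun n => A n k l) atTop (𝓝 (B k l))) :
    Tendsto (fun n => Matrix.det (Matrix.of (A n))) atTop (𝓝 (Matrix.det (Matrix.of B))) :=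
  ((continuous_id.matrix_det).tendsto (Matrix.of B)).comp
    (tendsto_pi_nhds.2 fun k => tendsto_pi_nhds.2 fun l => h k l)

/-! ### The three regimes. -/

theorem tendsto_add_div_sqrt (z₀ a : ℂ) :
    Tendsto (fun n : ℕ => z₀ + a / Real.sqrt n) atTop (𝓝 z₀) := by
  simpa using (tendsto_div_sqrt_natCast (tendsto_const_nhds (x := a))).const_add z₀

theorem tendsto_correlation_of_norm_lt_one {m : ℕ} (a : Fin m → ℂ) {z₀ : ℂ} (hz : ‖z₀‖ < 1) :
    Tendsto (fun n : ℕ => correlation gaussianPotential Set.univ n m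
        (fun k => z₀ + a k / Real.sqrt n) / (n : ℂ) ^ m) atTop
      (𝓝 (Matrix.det (Matrix.of fun k l : Fin m =>
        1 / (Real.pi : ℂ) * ginibreFactor (a k) (a l)))) := by
  refine Tendsto.congr' (((eventually_ge_atTop 1).mono fun n hn =>
    (correlation_gaussian_div_eq hn z₀ a).symm)) (tendsto_det_of fun k l => ?_)
  have hζ : Tendsto (fun n : ℕ => conj (z₀ + a k / Real.sqrt n) * (z₀ + a l / Real.sqrt n)) atTop
      (𝓝 ((‖z₀‖ ^ 2 : ℝ) : ℂ)) := by
    rw [Complex.ofReal_pow, ← Complex.conj_mul']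
    exact ((Complex.continuous_conj.tendsto _).comp (tendsto_add_div_sqrt z₀ (a k))).mul
      (tendsto_add_div_sqrt z₀ (a l))
  have h := tendsto_exp_neg_mul_expSum_of_lt_one hζ (by positivity)
    (pow_lt_one₀ (norm_nonneg _) hz two_ne_zero)
  simpa using (h.const_mul (1 / (Real.pi : ℂ))).mul_const (ginibreFactor (a k) (a l))

/-- Outside the disc phases are irrelevant: `‖w‖ ^ 2 + ‖z‖ ^ 2 ≥ 2 * ‖w‖ * ‖z‖` reduces to a real
series. -/
theorem norm_normalizedKernel_gaussian_div_le {n : ℕ} (hn : 1 ≤ n) (w z : ℂ) :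
    ‖normalizedKernel gaussianPotential Set.univ n w z / n‖ ≤
      1 / Real.pi * (Real.exp (-(n * (‖w‖ * ‖z‖))) *
        ∑ k ∈ Finset.range n, (n * (‖w‖ * ‖z‖)) ^ k / k.factorial) := by
  have hr : (0 : ℝ) < n := by exact_mod_cast hn
  have hn' : (n : ℂ) ≠ 0 := by exact_mod_cast hr.ne'
  have h1 := norm_expSum_le n (n * (conj w * z))
  simp only [norm_mul, Complex.norm_natCast, RCLike.norm_conj] at h1
  have h2 : normalizedKernel gaussianPotential Set.univ n w z / n
      = ((1 / Real.pi : ℝ) : ℂ) * ((Real.exp (-((n : ℝ) / 2) * (‖w‖ ^ 2 + ‖z‖ ^ 2)) : ℂ)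
        * expSum n (n * (conj w * z))) := by
    rw [normalizedKernel_gaussian hn]
    push_cast
    field_simp
  rw [h2, norm_mul, norm_mul, Complex.norm_of_nonneg (by positivity),
    Complex.norm_of_nonneg (Real.exp_pos _).le]
  gcongr
  nlinarith [mul_nonneg hr.le (sq_nonneg (‖w‖ - ‖z‖))]

theorem tendsto_correlation_of_one_lt_norm {m : ℕ} (hm : 1 ≤ m) (a : Fin m → ℂ) {z₀ : ℂ}
    (hz : 1 < ‖z₀‖) :
    Tendsto (fun n : ℕ => correlation gaussianPotential Set.univ n m
        (fun k => z₀ + a k / Real.sqrt n) / (n : ℂ) ^ m) atTop (𝓝 0) := by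
  -- This uses `1 ≤ m`: the empty determinant is 1.
  have h0 : Matrix.det (Matrix.of fun _ _ : Fin m => (0 : ℂ)) = 0 := by
    have : Nonempty (Fin m) := ⟨⟨0, hm⟩⟩
    exact Matrix.det_zero
  rw [← h0]
  refine Tendsto.congr (fun n => (correlation_div_eq n m _).symm) (tendsto_det_of fun k l => ?_)
  have hη : Tendsto (fun n : ℕ => ‖z₀ + a k / Real.sqrt n‖ * ‖z₀ + a l / Real.sqrt n‖) atTop
      (𝓝 (‖z₀‖ * ‖z₀‖)) :=
    (tendsto_add_div_sqrt z₀ (a k)).norm.mul (tendsto_add_div_sqrt z₀ (a l)).norm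
  have h := (tendsto_exp_neg_mul_sum_of_one_lt hη (fun n => by positivity)
    (by nlinarith)).const_mul (1 / Real.pi)
  rw [mul_zero] at h
  exact squeeze_zero_norm' ((eventually_ge_atTop 1).mono fun n hn =>
    norm_normalizedKernel_gaussian_div_le hn _ _) h

theorem tendsto_correlation_of_norm_eq_one {m : ℕ} (a : Fin m → ℂ) {z₀ : ℂ} (hz : ‖z₀‖ = 1) :
    Tendsto (fun n : ℕ => correlation gaussianPotential Set.univ n m
        (fun k => z₀ * (1 + a k / Real.sqrt n)) / (n : ℂ) ^ m) atTop
      (𝓝 (Matrix.det (Matrix.of fun k l : Fin m =>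
        erfc ((conj (a k) + a l) / Real.sqrt 2) / (2 * (Real.pi : ℂ))
          * ginibreFactor (a k) (a l)))) := by
  have hz1 : conj z₀ * z₀ = 1 := by rw [Complex.conj_mul', hz]; norm_num
  have hpt : ∀ (n : ℕ) k, z₀ * (1 + a k / Real.sqrt n) = z₀ + z₀ * a k / Real.sqrt n :=
    fun n k => by ring
  have hg : ∀ k l, ginibreFactor (z₀ * a k) (z₀ * a l) = ginibreFactor (a k) (a l) := by
    intro k l
    rw [ginibreFactor, ginibreFactor, ← mul_sub, norm_mul, hz, one_mul, map_mul,
      mul_mul_mul_comm, hz1, one_mul]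
  simp only [hpt]
  refine Tendsto.congr' (((eventually_ge_atTop 1).mono fun n hn =>
    (correlation_gaussian_div_eq hn z₀ fun k => z₀ * a k).symm)) (tendsto_det_of fun k l => ?_)
  rw [hg]
  -- The exact edge variable retains a term of order `1 / √n`, hence the edge limit is needed for
  -- sequences `s n`.
  have hs : Tendsto (fun n : ℕ => conj (a k) + a l + conj (a k) * a l / Real.sqrt n) atTop
      (𝓝 (conj (a k) + a l)) := tendsto_add_div_sqrt _ _
  have h := ((tendsto_exp_neg_mul_expSum_edge hs).const_mul (1 / (Real.pi : ℂ))).mul_const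
    (ginibreFactor (a k) (a l))
  have h2 : ∀ e : ℂ, 1 / (Real.pi : ℂ) * (e / 2) = e / (2 * Real.pi) := fun e => by
    field_simp
  rw [h2] at h
  refine h.congr' ((eventually_ge_atTop 1).mono fun n hn => ?_)
  have hr : (0 : ℝ) < n := by exact_mod_cast hn
  have hsq : ((Real.sqrt n : ℝ) : ℂ) ^ 2 = n := by exact_mod_cast Real.sq_sqrt hr.le
  have hq0 : ((Real.sqrt n : ℝ) : ℂ) ≠ 0 := by
    exact_mod_cast (Real.sqrt_pos.2 hr).ne'
  have h3 : (n : ℂ) * (conj (z₀ + z₀ * a k / Real.sqrt n) * (z₀ + z₀ * a l / Real.sqrt n))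
      = n + Real.sqrt n * (conj (a k) + a l + conj (a k) * a l / Real.sqrt n) := by
    rw [← hpt, ← hpt, map_mul, mul_mul_mul_comm, hz1, one_mul, map_add, map_div₀, map_one,
      Complex.conj_ofReal, ← hsq]
    field_simp
    ring
  simp only [h3]

end NormalMatrixModel

end

theorem mainTheorem11 (m : ℕ) (hm : 1 ≤ m) (a : Fin m → ℂ) (z₀ : ℂ) :
    (‖z₀‖ < 1 →
      Tendsto
        (fun n : ℕ => NormalMatrixModel.correlation NormalMatrixModel.gaussianPotential Set.univ n m
            (fun k => z₀ + a k / (Real.sqrt (n : ℝ) : ℂ)) / (n : ℂ) ^ m)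
        atTop
        (𝓝 (Matrix.det (Matrix.of fun k l : Fin m =>
          (1 / (Real.pi : ℂ)) *
            Complex.exp (-(1 / 2 : ℂ) * (‖a k - a l‖ : ℂ) ^ 2
              + Complex.I * ((conj (a k) * a l).im : ℂ)))))) ∧
    (1 < ‖z₀‖ →
      Tendsto
        (fun n : ℕ => NormalMatrixModel.correlation NormalMatrixModel.gaussianPotential Set.univ n m
            (fun k => z₀ + a k / (Real.sqrt (n : ℝ) : ℂ)) / (n : ℂ) ^ m)
        atTop (𝓝 0)) ∧
    (‖z₀‖ = 1 →
      Tendsto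
        (fun n : ℕ => NormalMatrixModel.correlation NormalMatrixModel.gaussianPotential Set.univ n m
            (fun k => z₀ * (1 + a k / (Real.sqrt (n : ℝ) : ℂ))) / (n : ℂ) ^ m)
        atTop
        (𝓝 (Matrix.det (Matrix.of fun k l : Fin m =>
          NormalMatrixModel.erfc ((conj (a k) + a l) / (Real.sqrt 2 : ℂ)) / (2 * (Real.pi : ℂ)) *
            Complex.exp (-(1 / 2 : ℂ) * (‖a k - a l‖ : ℂ) ^ 2
              + Complex.I * ((conj (a k) * a l).im : ℂ)))))) := by
  exact ⟨fun h => NormalMatrixModel.tendsto_correlation_of_norm_lt_one a h,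
    fun h => NormalMatrixModel.tendsto_correlation_of_one_lt_norm hm a h,
    fun h => NormalMatrixModel.tendsto_correlation_of_norm_eq_one a h⟩
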